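/- Fix an odd prime $p$. Let $\mu_{CL}$ be the Cohen–Lenstra measure on the set of isomorphism classes of finite abelian $p$-groups, i.e. the discrete measure with $$\mu_{CL}(B)=\frac{1}{|\mathrm{Aut}(B)|}\prod_{i\ge 1}(1-p^{-i}).$$ A pointed finite abelian $p$-group is a pair $(B,b)$ with $B$ a finite abelian $p$-group and $b\in B$; two such pairs $(B,b)$, $(C,c)$ are isomorphic if there is a group isomorphism $B\to C$ taking $b$ to $c$. Let $\mathbb{A}^{\bullet}$ be a set with one representative from each isomorphism class of pointed finite abelian $p$-groups. Let $\mu$ be the measure on isomorphism classes of pointed finite abelian $p$-groups obtained by drawing $B$ according to $\mu_{CL}$ and then a uniformly random element $b\in B$, so that $\mu(C,c)$ is the probability that the resulting pointed group $(B,b)$ is isomorphic to $(C,c)$. Let $\mathrm{Sur}((B,b),(A,a))$ denote the set of surjective group homomorphisms $B\to A$ taking $b$ to $a$. **Lemma (Pointed moments).** For every finite abelian $p$-group $A$ and every $a\in A$, $$\sum_{(B,b)\in\mathbb{A}^{\bullet}}|\mathrm{Sur}((B,b),(A,a))|\,\mu(B,b)=\frac{1}{|A|}.$$ -/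

import Mathlib

open MeasureTheory
open scoped ENNReal

/-- A finite abelian `p`-group, written additively. -/
structure FinAbPGroup (p : ℕ) where
  /-- The underlying type. -/
  carrier : Type
  [addCommGroup : AddCommGroup carrier]
  [finite : Finite carrier]
  /-- Every element has order a power of `p`. -/
  isPGroup : IsPGroup p (Multiplicative carrier)

attribute [instance] FinAbPGroup.addCommGroup FinAbPGroup.finite

/-- A pointed finite abelian `p`-group `(B, b)`. -/
structure PointedFinAbPGroup (p : ℕ) extends FinAbPGroup p where
  /-- The distinguished element. -/
  point : carrier

/-- Isomorphism of finite abelian `p`-groups. -/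
instance FinAbPGroup.isoSetoid (p : ℕ) : Setoid (FinAbPGroup p) where
  r B C := Nonempty (B.carrier ≃+ C.carrier)
  iseqv :=
    { refl := fun B => ⟨AddEquiv.refl B.carrier⟩
      symm := fun ⟨e⟩ => ⟨e.symm⟩
      trans := fun ⟨e⟩ ⟨f⟩ => ⟨e.trans f⟩ }

/-- Isomorphism of pointed groups: a group isomorphism taking base point to base point. -/
instance PointedFinAbPGroup.isoSetoid (p : ℕ) : Setoid (PointedFinAbPGroup p) where
  r B C := ∃ e : B.carrier ≃+ C.carrier, e B.point = C.point
  iseqv :=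
    { refl := fun B => ⟨AddEquiv.refl B.carrier, rfl⟩
      symm := fun ⟨e, he⟩ => ⟨e.symm, by rw [← he, AddEquiv.symm_apply_apply]⟩
      trans := fun ⟨e, he⟩ ⟨f, hf⟩ => ⟨e.trans f, by rw [AddEquiv.trans_apply, he, hf]⟩ }

/-- The set of isomorphism classes of finite abelian `p`-groups. -/
def FinAbPGroupClass (p : ℕ) : Type 1 := Quotient (FinAbPGroup.isoSetoid p)

/-- The set of isomorphism classes of pointed finite abelian `p`-groups. -/
def PointedFinAbPGroupClass (p : ℕ) : Type 1 := Quotient (PointedFinAbPGroup.isoSetoid p)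

/-- The σ-algebra is the full power set. -/
instance FinAbPGroupClass.measurableSpace (p : ℕ) : MeasurableSpace (FinAbPGroupClass p) := ⊤

/-- The σ-algebra is the full power set. -/
instance PointedFinAbPGroupClass.measurableSpace (p : ℕ) :
    MeasurableSpace (PointedFinAbPGroupClass p) := ⊤

/-- A chosen representative of an isomorphism class of groups. -/
noncomputable def FinAbPGroupClass.rep {p : ℕ} (B : FinAbPGroupClass p) : FinAbPGroup p :=
  Quotient.out B

/-- A chosen representative `(B, b)` of an isomorphism class of pointed groups. -/
noncomputable def PointedFinAbPGroupClass.rep {p : ℕ} (B : PointedFinAbPGroupClass p) :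
    PointedFinAbPGroup p :=
  Quotient.out B

/-- The isomorphism class of the pointed group `(B, b)`. -/
def FinAbPGroup.pointedClass {p : ℕ} (B : FinAbPGroup p) (b : B.carrier) :
    PointedFinAbPGroupClass p :=
  Quotient.mk (PointedFinAbPGroup.isoSetoid p) ⟨B, b⟩

/-- The Cohen–Lenstra weight `|Aut B|⁻¹ ∏_{i ≥ 1} (1 - p^{-i})` of a finite abelian `p`-group. -/
noncomputable def cohenLenstraWeight {p : ℕ} (B : FinAbPGroup p) : ℝ :=
  1 / (Nat.card (B.carrier ≃+ B.carrier) : ℝ) * ∏' i : ℕ, (1 - ((p : ℝ) ^ (i + 1))⁻¹)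

/-- The infinite product above converges when `p` is a prime, so `∏'` denotes its value. -/
theorem multipliable_cohenLenstra {p : ℕ} (hp : p.Prime) :
    Multipliable fun i : ℕ => 1 - ((p : ℝ) ^ (i + 1))⁻¹ := by
  have h1 : (1 : ℝ) < p := by exact_mod_cast hp.one_lt
  have hs : Summable fun i : ℕ => -((p : ℝ) ^ (i + 1))⁻¹ := by
    have h := (summable_geometric_of_lt_one (inv_nonneg.2 (zero_le_one.trans h1.le))
      (inv_lt_one_of_one_lt₀ h1)).mul_left (-((p : ℝ)⁻¹))
    refine h.congr fun i => ?_
    rw [pow_succ, mul_inv, inv_pow]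
    ring
  simpa [sub_eq_add_neg] using Real.multipliable_one_add_of_summable hs

/-- The Cohen–Lenstra measure on isomorphism classes of finite abelian `p`-groups: the discrete
measure giving the class of `B` its Cohen–Lenstra weight. -/
noncomputable def cohenLenstraMeasure (p : ℕ) : Measure (FinAbPGroupClass p) :=
  Measure.sum fun B => ENNReal.ofReal (cohenLenstraWeight B.rep) • Measure.dirac B

/-- The law of the isomorphism class of `(B, b)`, where `b` is a uniform element of the fixed
group `B`. -/
noncomputable def uniformPointing {p : ℕ} (B : FinAbPGroup p) :
    Measure (PointedFinAbPGroupClass p) :=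
  letI : Fintype B.carrier := Fintype.ofFinite B.carrier
  ((PMF.uniformOfFintype B.carrier).map B.pointedClass).toMeasure

/-- The measure `μ` on isomorphism classes of pointed groups: draw `B` from the Cohen–Lenstra
measure, then a uniform element `b` of `B`, and take the class of `(B, b)`. -/
noncomputable def pointedMeasure (p : ℕ) : Measure (PointedFinAbPGroupClass p) :=
  (cohenLenstraMeasure p).bind fun B => uniformPointing B.rep

/-- `Sur((B, b), (A, a))`: the surjective homomorphisms `B → A` that take `b` to `a`. -/
def PointedSur {B A : Type*} [AddCommGroup B] [AddCommGroup A] (b : B) (a : A) : Type _ :=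
  {f : B →+ A // Function.Surjective f ∧ f b = a}

/-!
The inner average over the base point is elementary: a surjection `B → A` takes `|B| / |A|` elements
of `B` to `a`, so a uniform `b` admits on average `|Sur(B, A)| / |A|` pointed surjections. It
remains to see that `|Sur(B, A)|` has mean one for the Cohen–Lenstra measure
(`tsum_cohenLenstraWeight_mul_card_addSurj`).

This is done by counting sublattices of `ℤ ^ n`. A surjection `ℤ ^ n → B` is a subgroup `H` with
`ℤ ^ n ⧸ H ≃ B` together with an automorphism of `B`, and a surjection `ℤ ^ n ⧸ H → A` is a
surjection `φ : ℤ ^ n → A` with `H ≤ ker φ`. Hence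
`∑_B |Sur(ℤ ^ n, B)| |Sur(B, A)| / (|B| ^ n |Aut B|)` is the sum over all `φ` of
`∑_{H ≤ ker φ} [ℤ ^ n : H] ^ (-n)`, where `H` runs over subgroups of `p`-power index. As `ker φ` has
index `|A|` and is itself isomorphic to `ℤ ^ n`, the inner sum is
`|A| ^ (-n)` times the `p`-part at `s = n` of the subgroup zeta function of `ℤ ^ n`, which is
`∏_{i = 1}^n (1 - p ^ (-i))⁻¹` (`pSubgroupZeta_pi_int`, by induction on `n`). This is
`tsum_generatingProb_mul`. As `n → ∞`, the proportion `|Sur(ℤ ^ n, B)| / |B| ^ n` of generating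
tuples is at most one and tends to one, which gives `∑_B |Sur(B, A)| / |Aut B|`.
-/

/-! ### The subgroup zeta function -/

/-- The type of subgroups of `G` whose index is a power of `p`. -/
abbrev PPowerIndexSubgroup (p : ℕ) (G : Type*) [AddCommGroup G] : Type _ :=
  {H : AddSubgroup G // ∃ k : ℕ, H.index = p ^ k}

/-- The `p`-part of the subgroup zeta function of `G` at `s = n`: the sum of `[G : H] ^ (-n)` over
the subgroups `H` of `p`-power index, as an extended nonnegative real. -/
noncomputable def pSubgroupZeta (p n : ℕ) (G : Type*) [AddCommGroup G] : ℝ≥0∞ :=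
  ∑' H : PPowerIndexSubgroup p G, ((H.1.index : ℝ≥0∞) ^ n)⁻¹

theorem pSubgroupZeta_congr (p n : ℕ) {G G' : Type*} [AddCommGroup G] [AddCommGroup G']
    (e : G ≃+ G') : pSubgroupZeta p n G = pSubgroupZeta p n G' := by
  refine Eq.trans (tsum_congr fun H => ?_) (Equiv.tsum_eq
    (e.mapAddSubgroup.toEquiv.subtypeEquiv fun H => by simp) _)
  simp

/-! ### Subgroups of `ℤ × G` -/

/-- The subgroup of `ℤ × G` generated by `0 × H` and by `(d, x)`, for any lift `x ∈ G` of
`y ∈ G ⧸ H`. -/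
def extendSubgroup {G : Type*} [AddCommGroup G] (d : ℤ) (H : AddSubgroup G) (y : G ⧸ H) :
    AddSubgroup (ℤ × G) where
  carrier := {z | ∃ c : ℤ, z.1 = c * d ∧ (z.2 : G ⧸ H) = c • y}
  zero_mem' := ⟨0, by simp⟩
  add_mem' := by
    rintro a b ⟨c, h1, h2⟩ ⟨c', h3, h4⟩
    exact ⟨c + c', by simp [h1, h3, add_mul], by simp [h2, h4, add_smul]⟩
  neg_mem' := by
    rintro a ⟨c, h1, h2⟩
    exact ⟨-c, by simp [h1], by simp [h2]⟩

section
variable {G : Type*} [AddCommGroup G]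

theorem mem_extendSubgroup {d : ℤ} {H : AddSubgroup G} {y : G ⧸ H} {z : ℤ × G} :
    z ∈ extendSubgroup d H y ↔ ∃ c : ℤ, z.1 = c * d ∧ (z.2 : G ⧸ H) = c • y := Iff.rfl

theorem comap_inr_extendSubgroup {d : ℤ} (hd : d ≠ 0) (H : AddSubgroup G) (y : G ⧸ H) :
    (extendSubgroup d H y).comap (AddMonoidHom.inr ℤ G) = H := by
  ext g
  rw [AddSubgroup.mem_comap, mem_extendSubgroup]
  constructor
  · rintro ⟨c, h1, h2⟩
    have hc : c = 0 := by simpa [hd] using h1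
    subst hc
    simpa using h2
  · intro hg
    exact ⟨0, by simp, by simpa using hg⟩

theorem map_fst_extendSubgroup (d : ℤ) (H : AddSubgroup G) (y : G ⧸ H) :
    (extendSubgroup d H y).map (AddMonoidHom.fst ℤ G) = AddSubgroup.zmultiples d := by
  ext m
  rw [AddSubgroup.mem_map, AddSubgroup.mem_zmultiples_iff]
  constructor
  · rintro ⟨z, ⟨c, h1, -⟩, rfl⟩
    exact ⟨c, by simp [h1]⟩
  · rintro ⟨c, rfl⟩
    obtain ⟨x, rfl⟩ := QuotientAddGroup.mk_surjective y
    exact ⟨(c * d, c • x), ⟨c, rfl, rfl⟩, by simp⟩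

/-- The index of a subgroup of `ℤ × G` is multiplicative along `0 → G → ℤ × G → ℤ → 0`. -/
theorem index_eq_index_map_mul_index_comap (H : AddSubgroup (ℤ × G)) :
    H.index = (H.map (AddMonoidHom.fst ℤ G)).index * (H.comap (AddMonoidHom.inr ℤ G)).index := by
  have hker : (AddMonoidHom.fst ℤ G).ker = (AddMonoidHom.inr ℤ G).range := by
    ext ⟨m, g⟩
    rw [AddMonoidHom.mem_ker, AddMonoidHom.mem_range]
    exact ⟨fun h => ⟨g, Prod.ext (Eq.symm h) rfl⟩, fun ⟨x, hx⟩ => (congrArg Prod.fst hx).symm⟩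
  rw [AddSubgroup.index_map, AddSubgroup.index_comap, ← hker,
    AddMonoidHom.range_eq_top.2 (fun m => ⟨(m, 0), rfl⟩), AddSubgroup.index_top, mul_one,
    ← AddSubgroup.relIndex_sup_right, mul_comm,
    sup_comm H, AddSubgroup.relIndex_mul_index le_sup_right]

theorem index_extendSubgroup {d : ℤ} (hd : d ≠ 0) (H : AddSubgroup G) (y : G ⧸ H) :
    (extendSubgroup d H y).index = d.natAbs * H.index := by
  rw [index_eq_index_map_mul_index_comap, comap_inr_extendSubgroup hd, map_fst_extendSubgroup,
    Int.index_zmultiples]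

theorem extendSubgroup_injective {d : ℤ} (hd : d ≠ 0) (H : AddSubgroup G) :
    Function.Injective (extendSubgroup d H) := by
  intro y y' h
  obtain ⟨x, rfl⟩ := QuotientAddGroup.mk_surjective y
  have hx : (d, x) ∈ extendSubgroup d H x := ⟨1, by simp, by simp⟩
  rw [h] at hx
  obtain ⟨c, h1, h2⟩ := hx
  have hc : c = 1 := by
    have h1' : d = c * d := h1
    exact mul_right_cancel₀ hd (by rw [one_mul, ← h1'])
  simpa [hc] using h2

/-- The class that recovers `K` is that of any `x` with `(d, x) ∈ K`. -/
theorem exists_eq_extendSubgroup {d : ℤ} {K : AddSubgroup (ℤ × G)}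
    (hK : K.map (AddMonoidHom.fst ℤ G) = AddSubgroup.zmultiples d) :
    ∃ y, extendSubgroup d (K.comap (AddMonoidHom.inr ℤ G)) y = K := by
  have hd : d ∈ K.map (AddMonoidHom.fst ℤ G) := by rw [hK]; exact AddSubgroup.mem_zmultiples d
  obtain ⟨⟨d', x⟩, hx, rfl⟩ := hd
  change K.map _ = AddSubgroup.zmultiples d' at hK
  refine ⟨(x : G ⧸ _), ?_⟩
  have key : ∀ (c : ℤ) (g : G), (c * d', g) ∈ K ↔
      (g : G ⧸ K.comap (AddMonoidHom.inr ℤ G)) = c • (x : G ⧸ K.comap (AddMonoidHom.inr ℤ G)) := by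
    intro c g
    rw [← QuotientAddGroup.mk_zsmul, eq_comm, QuotientAddGroup.eq, AddSubgroup.mem_comap,
      ← AddSubgroup.add_mem_cancel_left K (K.zsmul_mem hx c) (y := AddMonoidHom.inr ℤ G _)]
    simp
  ext ⟨m, g⟩
  rw [mem_extendSubgroup]
  constructor
  · rintro ⟨c, h1, h2⟩
    obtain rfl : m = c * d' := h1
    exact (key c g).2 h2
  · intro h
    have hm : m ∈ K.map (AddMonoidHom.fst ℤ G) := ⟨_, h, rfl⟩
    rw [hK, AddSubgroup.mem_zmultiples_iff] at hm
    obtain ⟨c, rfl⟩ := hm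
    exact ⟨c, by simp, (key c g).1 (by simpa using h)⟩

/-- Subgroups of `ℤ × G` of `p`-power index are classified by their intersection `H` with `G`, the
exponent `k` for which their projection to `ℤ` is `p ^ k ℤ`, and a class in `G ⧸ H`. -/
noncomputable def extendSubgroupEquiv {p : ℕ} (hp : p.Prime) :
    (Σ q : PPowerIndexSubgroup p G × ℕ, G ⧸ q.1.1) ≃ PPowerIndexSubgroup p (ℤ × G) :=
  have h0 : ∀ k : ℕ, ((p ^ k : ℕ) : ℤ) ≠ 0 := fun k => by exact_mod_cast pow_ne_zero k hp.ne_zero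
  Equiv.ofBijective
    (fun x => ⟨extendSubgroup ((p ^ x.1.2 : ℕ) : ℤ) x.1.1.1 x.2, by
      obtain ⟨j, hj⟩ := x.1.1.2
      refine ⟨x.1.2 + j, ?_⟩
      rw [index_extendSubgroup (h0 _), hj, Int.natAbs_natCast, pow_add]⟩) <| by
    constructor
    · rintro ⟨⟨⟨H, hH⟩, k⟩, y⟩ ⟨⟨⟨H', hH'⟩, k'⟩, y'⟩ h
      have h : extendSubgroup ((p ^ k : ℕ) : ℤ) H y = extendSubgroup ((p ^ k' : ℕ) : ℤ) H' y' :=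
        congrArg Subtype.val h
      have h1 := comap_inr_extendSubgroup (h0 k) H y
      rw [h, comap_inr_extendSubgroup (h0 k')] at h1
      subst h1
      have h2 := index_extendSubgroup (h0 k) H' y
      rw [h, index_extendSubgroup (h0 k'), Int.natAbs_natCast, Int.natAbs_natCast] at h2
      have hi : H'.index ≠ 0 := by
        obtain ⟨j, hj⟩ := hH
        rw [hj]
        exact pow_ne_zero j hp.ne_zero
      have h3 : k' = k := Nat.pow_right_injective hp.two_le (mul_right_cancel₀ hi h2)
      subst h3
      have h4 := extendSubgroup_injective (h0 k') H' h
      subst h4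
      rfl
    · rintro ⟨K, j, hK⟩
      rw [index_eq_index_map_mul_index_comap] at hK
      obtain ⟨k, -, hk⟩ := (Nat.dvd_prime_pow hp).1 (Dvd.intro _ hK)
      obtain ⟨l, -, hl⟩ := (Nat.dvd_prime_pow hp).1 (Dvd.intro_left _ hK)
      have hmap : K.map (AddMonoidHom.fst ℤ G) = AddSubgroup.zmultiples ((p ^ k : ℕ) : ℤ) := by
        obtain ⟨a, ha⟩ := Int.subgroup_cyclic (K.map (AddMonoidHom.fst ℤ G))
        rw [← AddSubgroup.zmultiples_eq_closure] at ha
        rw [ha, Int.index_zmultiples] at hk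
        rw [ha, ← hk, Int.zmultiples_natAbs]
      obtain ⟨y, hy⟩ := exists_eq_extendSubgroup hmap
      exact ⟨⟨⟨⟨_, l, hl⟩, k⟩, y⟩, Subtype.ext hy⟩

theorem index_extendSubgroupEquiv {p : ℕ} (hp : p.Prime)
    (x : Σ q : PPowerIndexSubgroup p G × ℕ, G ⧸ q.1.1) :
    (extendSubgroupEquiv hp x).1.index = p ^ x.1.2 * x.1.1.1.index := by
  rw [← Int.natAbs_natCast (p ^ x.1.2)]
  exact index_extendSubgroup (by exact_mod_cast pow_ne_zero _ hp.ne_zero) _ _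

/-- With `H` and `k` fixed there are `[G : H]` subgroups, each of index `p ^ k [G : H]`; this
factor `[G : H]` lowers the exponent from `n + 1` to `n`, and the sum over `k` is geometric. -/
theorem pSubgroupZeta_int_prod {p : ℕ} (hp : p.Prime) (n : ℕ) :
    pSubgroupZeta p (n + 1) (ℤ × G) =
      (1 - ((p : ℝ≥0∞) ^ (n + 1))⁻¹)⁻¹ * pSubgroupZeta p n G := by
  have hterm : ∀ (H : PPowerIndexSubgroup p G) (k : ℕ),
      ∑' y : G ⧸ H.1, (((extendSubgroupEquiv hp ⟨(H, k), y⟩).1.index : ℝ≥0∞) ^ (n + 1))⁻¹ =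
        (((p : ℝ≥0∞) ^ (n + 1))⁻¹) ^ k * ((H.1.index : ℝ≥0∞) ^ n)⁻¹ := by
    rintro ⟨H, j, hj⟩ k
    have hH0 : (H.index : ℝ≥0∞) ≠ 0 := by
      rw [hj]; exact_mod_cast pow_ne_zero j hp.ne_zero
    have hHt : (H.index : ℝ≥0∞) ≠ ⊤ := ENNReal.natCast_ne_top _
    have : H.FiniteIndex := ⟨by exact_mod_cast hH0⟩
    simp only [index_extendSubgroupEquiv, ENNReal.tsum_const, ENat.card_eq_coe_natCard]
    change (H.index : ℝ≥0∞) * _ = _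
    push_cast
    rw [mul_pow, ENNReal.mul_inv (Or.inr (ENNReal.pow_ne_top hHt)) (Or.inr (pow_ne_zero _ hH0)),
      pow_succ (H.index : ℝ≥0∞), ENNReal.mul_inv (Or.inr hHt) (Or.inr hH0), ← pow_mul, mul_comm k,
      pow_mul, ENNReal.inv_pow, mul_left_comm, mul_left_comm (H.index : ℝ≥0∞),
      ENNReal.mul_inv_cancel hH0 hHt, mul_one]
  rw [pSubgroupZeta, ← (extendSubgroupEquiv hp).tsum_eq, ENNReal.tsum_sigma', ENNReal.tsum_prod']
  simp only [hterm, ENNReal.tsum_mul_right, ENNReal.tsum_geometric, ENNReal.tsum_mul_left]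
  rfl

end

/-- The `p`-part of the zeta function of `ℤ ^ n` at `s = n` is `∏_{i = 1}^n (1 - p^{-i})⁻¹`. -/
theorem pSubgroupZeta_pi_int {p : ℕ} (hp : p.Prime) (n : ℕ) :
    pSubgroupZeta p n (Fin n → ℤ) =
      ∏ i ∈ Finset.range n, (1 - ((p : ℝ≥0∞) ^ (i + 1))⁻¹)⁻¹ := by
  induction n with
  | zero =>
    have : Unique (PPowerIndexSubgroup p (Fin 0 → ℤ)) :=
      { default := ⟨⊤, 0, by simp⟩
        uniq := fun H => Subsingleton.elim _ _ }
    simp [pSubgroupZeta]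
  | succ n ih =>
    rw [← pSubgroupZeta_congr p (n + 1)
        (Fin.consLinearEquiv ℤ (fun _ : Fin (n + 1) => ℤ)).toAddEquiv,
      pSubgroupZeta_int_prod hp, ih, Finset.prod_range_succ, mul_comm]

/-! ### Surjections and subgroups -/

/-- The surjective homomorphisms `B → A`. -/
abbrev AddSurj (B A : Type*) [AddCommGroup B] [AddCommGroup A] : Type _ :=
  {f : B →+ A // Function.Surjective f}

section
variable {G A : Type*} [AddCommGroup G] [AddCommGroup A]

/-- Surjections out of isomorphic groups correspond. -/
def AddSurj.congrLeft {B C : Type*} [AddCommGroup B] [AddCommGroup C] (e : B ≃+ C) :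
    AddSurj B A ≃ AddSurj C A where
  toFun f := ⟨f.1.comp e.symm.toAddMonoidHom, f.2.comp e.symm.surjective⟩
  invFun f := ⟨f.1.comp e.toAddMonoidHom, f.2.comp e.surjective⟩
  left_inv f := by ext; simp
  right_inv f := by ext; simp

/-- Surjections `G ⧸ H → A` are the surjections `G → A` whose kernel contains `H`. -/
def AddSurj.quotientEquiv (H : AddSubgroup G) :
    AddSurj (G ⧸ H) A ≃ {φ : AddSurj G A // H ≤ φ.1.ker} where
  toFun f := ⟨⟨f.1.comp (QuotientAddGroup.mk' H), f.2.comp (QuotientAddGroup.mk'_surjective H)⟩,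
    fun x hx => by
      rw [AddMonoidHom.mem_ker, AddMonoidHom.comp_apply, QuotientAddGroup.mk'_apply,
        (QuotientAddGroup.eq_zero_iff x).2 hx, map_zero]⟩
  invFun φ := ⟨QuotientAddGroup.lift H φ.1.1 φ.2,
    QuotientAddGroup.lift_surjective_of_surjective H _ φ.1.2 φ.2⟩
  left_inv f := by
    apply Subtype.ext
    apply QuotientAddGroup.addMonoidHom_ext
    ext x
    rfl
  right_inv φ := by
    ext x
    rfl

/-- The subgroups of `G` of `p`-power index contained in a subgroup `K` of `p`-power index are the
subgroups of `K` of `p`-power index. -/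
def subgroupsLEEquiv {p : ℕ} (hp : p.Prime) (K : PPowerIndexSubgroup p G) :
    {H : PPowerIndexSubgroup p G // H.1 ≤ K.1} ≃ PPowerIndexSubgroup p K.1 where
  toFun H := ⟨H.1.1.addSubgroupOf K.1, by
    obtain ⟨k, hk⟩ := H.1.2
    have h := AddSubgroup.relIndex_mul_index H.2
    rw [hk] at h
    obtain ⟨j, -, hj⟩ := (Nat.dvd_prime_pow hp).1 (Dvd.intro _ h)
    exact ⟨j, hj⟩⟩
  invFun H := ⟨⟨H.1.map K.1.subtype, by
    obtain ⟨k, hk⟩ := H.2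
    obtain ⟨j, hj⟩ := K.2
    exact ⟨k + j, by rw [AddSubgroup.index_map_subtype, hk, hj, pow_add]⟩⟩,
    AddSubgroup.map_subtype_le H.1⟩
  left_inv H := Subtype.ext (Subtype.ext (AddSubgroup.map_addSubgroupOf_eq_of_le H.2))
  right_inv H := Subtype.ext (AddSubgroup.comap_map_eq_self_of_injective
    (AddSubgroup.subtype_injective K.1) H.1)

open Classical in
/-- The zeta sum restricted to the subgroups of `K`, by multiplicativity of the index. -/
theorem tsum_subgroups_le {p : ℕ} (hp : p.Prime) (n : ℕ) (K : PPowerIndexSubgroup p G) :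
    ∑' H : PPowerIndexSubgroup p G, (if H.1 ≤ K.1 then ((H.1.index : ℝ≥0∞) ^ n)⁻¹ else 0) =
      ((K.1.index : ℝ≥0∞) ^ n)⁻¹ * pSubgroupZeta p n K.1 := by
  have hK0 : (K.1.index : ℝ≥0∞) ≠ 0 := by
    obtain ⟨k, hk⟩ := K.2
    rw [hk]
    exact_mod_cast pow_ne_zero k hp.ne_zero
  have h := tsum_subtype {H : PPowerIndexSubgroup p G | H.1 ≤ K.1}
    (fun H => ((H.1.index : ℝ≥0∞) ^ n)⁻¹)
  simp only [Set.indicator_apply, Set.mem_ofPred_eq] at h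
  rw [← h, pSubgroupZeta, ← (subgroupsLEEquiv hp K).tsum_eq, ← ENNReal.tsum_mul_left]
  refine tsum_congr fun H => ?_
  rw [← AddSubgroup.relIndex_mul_index H.2, mul_comm, Nat.cast_mul, mul_pow, ENNReal.mul_inv
    (Or.inl (pow_ne_zero _ hK0)) (Or.inl (ENNReal.pow_ne_top (ENNReal.natCast_ne_top _)))]
  rfl

end

/-! ### Quotients of a group and their automorphisms -/

/-- The quotient of `G` by a subgroup of `p`-power index. -/
def quotientPGroup {p : ℕ} (hp : p.Prime) {G : Type} [AddCommGroup G]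
    (H : PPowerIndexSubgroup p G) : FinAbPGroup p where
  carrier := G ⧸ H.1
  finite := by
    obtain ⟨k, hk⟩ := H.2
    have : H.1.FiniteIndex := ⟨by rw [hk]; exact pow_ne_zero k hp.ne_zero⟩
    infer_instance
  isPGroup := by
    obtain ⟨k, hk⟩ := H.2
    exact IsPGroup.of_card (n := k) hk

/-- The isomorphism class of `G ⧸ H`. -/
def quotientClass {p : ℕ} (hp : p.Prime) {G : Type} [AddCommGroup G]
    (H : PPowerIndexSubgroup p G) : FinAbPGroupClass p :=
  Quotient.mk _ (quotientPGroup hp H)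

theorem quotientClass_eq_iff {p : ℕ} (hp : p.Prime) {G : Type} [AddCommGroup G]
    (H : PPowerIndexSubgroup p G) (B : FinAbPGroupClass p) :
    quotientClass hp H = B ↔ Nonempty (G ⧸ H.1 ≃+ B.rep.carrier) := by
  conv_lhs => rw [← Quotient.out_eq B]
  exact Quotient.eq

/-- A surjection `G → B` amounts to a subgroup `H` with `G ⧸ H ≃ B` and an automorphism of `B`.
The correspondence depends on the choice of an isomorphism `G ⧸ H ≃ B` for each `H`. -/
noncomputable def fiberProdAutEquiv {p : ℕ} (hp : p.Prime) {G : Type} [AddCommGroup G]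
    (B : FinAbPGroupClass p) :
    (quotientClass hp (G := G) ⁻¹' {B}) × (B.rep.carrier ≃+ B.rep.carrier) ≃
      AddSurj G B.rep.carrier :=
  have e (H : quotientClass hp (G := G) ⁻¹' {B}) : G ⧸ H.1.1 ≃+ B.rep.carrier :=
    ((quotientClass_eq_iff hp H.1 B).1 H.2).some
  Equiv.ofBijective (fun x => ⟨(((e x.1).trans x.2).toAddMonoidHom).comp (QuotientAddGroup.mk' _),
      ((e x.1).trans x.2).surjective.comp (QuotientAddGroup.mk'_surjective _)⟩) <| by
    constructor
    · rintro ⟨H, α⟩ ⟨H', α'⟩ h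
      have h : ∀ g : G, α (e H g) = α' (e H' g) := fun g =>
        DFunLike.congr_fun (congrArg Subtype.val h) g
      obtain rfl : H = H' := by
        apply Subtype.ext
        apply Subtype.ext
        ext g
        rw [← QuotientAddGroup.eq_zero_iff, ← QuotientAddGroup.eq_zero_iff (N := H'.1.1),
          ← (e H).map_eq_zero_iff, ← α.map_eq_zero_iff, h, α'.map_eq_zero_iff,
          (e H').map_eq_zero_iff]
      obtain rfl : α = α' := by
        ext b
        obtain ⟨x, rfl⟩ := (e H).surjective b
        obtain ⟨g, rfl⟩ := QuotientAddGroup.mk_surjective x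
        exact h g
      rfl
    · rintro ⟨f, hf⟩
      have e0 := QuotientAddGroup.quotientKerEquivOfSurjective f hf
      have hidx : ∃ k : ℕ, f.ker.index = p ^ k := by
        have := Fact.mk hp
        obtain ⟨k, hk⟩ := IsPGroup.iff_card.1 B.rep.isPGroup
        exact ⟨k, (Nat.card_congr e0.toEquiv).trans hk⟩
      let H : quotientClass hp (G := G) ⁻¹' {B} :=
        ⟨⟨f.ker, hidx⟩, (quotientClass_eq_iff hp _ B).2 ⟨e0⟩⟩
      refine ⟨⟨H, (e H).symm.trans (QuotientAddGroup.quotientKerEquivOfSurjective f hf)⟩, ?_⟩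
      ext g
      change QuotientAddGroup.quotientKerEquivOfSurjective f hf
        ((e H).symm (e H (g : G ⧸ f.ker))) = f g
      rw [AddEquiv.symm_apply_apply]
      rfl

/-- Summing over the subgroups of `p`-power index of `G` is summing over groups `B` with the
multiplicity `|Sur(G, B)| / |Aut B|`. -/
theorem tsum_quotientClass {p : ℕ} (hp : p.Prime) {G : Type} [AddCommGroup G]
    (hG : ∀ B : FinAbPGroup p, Finite (G →+ B.carrier)) (F : FinAbPGroupClass p → ℝ≥0∞) :
    ∑' H : PPowerIndexSubgroup p G, F (quotientClass hp H) =
      ∑' B : FinAbPGroupClass p, (Nat.card (AddSurj G B.rep.carrier) : ℝ≥0∞) *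
        (Nat.card (B.rep.carrier ≃+ B.rep.carrier) : ℝ≥0∞)⁻¹ * F B := by
  rw [← ENNReal.tsum_fiberwise _ (quotientClass hp)]
  refine tsum_congr fun B => ?_
  have := hG B.rep
  have hfin : Finite (AddSurj G B.rep.carrier) := inferInstance
  have hfin' := Finite.of_equiv _ (fiberProdAutEquiv hp (G := G) B).symm
  have : Finite (quotientClass hp (G := G) ⁻¹' {B}) :=
    Finite.prod_left (B.rep.carrier ≃+ B.rep.carrier)
  have hF : ∀ H : quotientClass hp (G := G) ⁻¹' {B}, F (quotientClass hp H.1) = F B :=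
    fun H => congrArg F H.2
  have h0 : (Nat.card (B.rep.carrier ≃+ B.rep.carrier) : ℝ≥0∞) ≠ 0 := by
    exact_mod_cast Nat.card_pos.ne'
  simp only [hF, ENNReal.tsum_const, ENat.card_eq_coe_natCard]
  rw [← Nat.card_congr (fiberProdAutEquiv hp (G := G) B), Nat.card_prod, Nat.cast_mul,
    ENNReal.mul_inv_cancel_right h0 (ENNReal.natCast_ne_top _)]
  rfl

/-! ### Surjections out of `ℤ ^ n` -/

/-- Homomorphisms out of `ℤ ^ n` are `n`-tuples. -/
noncomputable def piIntHomEquiv (n : ℕ) (B : Type*) [AddCommGroup B] :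
    ((Fin n → ℤ) →+ B) ≃ (Fin n → B) :=
  (addMonoidHomLequivInt ℤ).toEquiv.trans ((Pi.basisFun ℤ (Fin n)).constr ℤ).symm.toEquiv

theorem card_piIntHom (n : ℕ) (B : Type*) [AddCommGroup B] :
    Nat.card ((Fin n → ℤ) →+ B) = Nat.card B ^ n := by
  rw [Nat.card_congr (piIntHomEquiv n B), Nat.card_fun, Nat.card_fin]

instance finite_piIntHom (n : ℕ) (B : Type*) [AddCommGroup B] [Finite B] :
    Finite ((Fin n → ℤ) →+ B) :=
  Finite.of_equiv _ (piIntHomEquiv n B).symm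

/-- The probability that `n` uniform elements of `B` generate `B`, for finite `B`: generating
`n`-tuples are encoded as surjections from `ℤ ^ n`. -/
noncomputable def generatingProb (n : ℕ) (B : Type*) [AddCommGroup B] : ℝ≥0∞ :=
  (Nat.card (AddSurj (Fin n → ℤ) B) : ℝ≥0∞) * ((Nat.card B : ℝ≥0∞) ^ n)⁻¹

/-- The approximation of the Cohen–Lenstra moment of `A` by quotients of `ℤ ^ n`. -/
theorem tsum_generatingProb_mul {p : ℕ} (hp : p.Prime) (n : ℕ) (A : Type*) [AddCommGroup A]
    [Finite A] (hA : IsPGroup p (Multiplicative A)) :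
    ∑' B : FinAbPGroupClass p, generatingProb n B.rep.carrier *
        ((Nat.card (B.rep.carrier ≃+ B.rep.carrier) : ℝ≥0∞)⁻¹ *
          Nat.card (AddSurj B.rep.carrier A)) =
      generatingProb n A * ∏ i ∈ Finset.range n, (1 - ((p : ℝ≥0∞) ^ (i + 1))⁻¹)⁻¹ := by
  classical
  have hsur : ∀ H : PPowerIndexSubgroup p (Fin n → ℤ),
      (Nat.card (AddSurj (quotientClass hp H).rep.carrier A) : ℝ≥0∞) *
          ((Nat.card (quotientClass hp H).rep.carrier : ℝ≥0∞) ^ n)⁻¹ =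
        ∑' φ : AddSurj (Fin n → ℤ) A,
          if H.1 ≤ φ.1.ker then ((H.1.index : ℝ≥0∞) ^ n)⁻¹ else 0 := by
    intro H
    obtain ⟨e⟩ := (quotientClass_eq_iff hp H _).1 rfl
    have hcard : Nat.card (quotientClass hp H).rep.carrier = H.1.index :=
      (Nat.card_congr e.toEquiv).symm
    have h := tsum_subtype {φ : AddSurj (Fin n → ℤ) A | H.1 ≤ φ.1.ker}
      (fun _ => ((H.1.index : ℝ≥0∞) ^ n)⁻¹)
    simp only [Set.indicator_apply, Set.mem_ofPred_eq] at h
    rw [← h, ENNReal.tsum_const, ENat.card_eq_coe_natCard, hcard,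
      ← Nat.card_congr (AddSurj.congrLeft e), Nat.card_congr (AddSurj.quotientEquiv H.1)]
    rfl
  have hker : ∀ φ : AddSurj (Fin n → ℤ) A, φ.1.ker.index = Nat.card A := fun φ =>
    Nat.card_congr (QuotientAddGroup.quotientKerEquivOfSurjective φ.1 φ.2).toEquiv
  have hzeta : ∀ φ : AddSurj (Fin n → ℤ) A,
      ∑' H : PPowerIndexSubgroup p (Fin n → ℤ),
          (if H.1 ≤ φ.1.ker then ((H.1.index : ℝ≥0∞) ^ n)⁻¹ else 0) =
        ((Nat.card A : ℝ≥0∞) ^ n)⁻¹ *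
          ∏ i ∈ Finset.range n, (1 - ((p : ℝ≥0∞) ^ (i + 1))⁻¹)⁻¹ := by
    intro φ
    have := Fact.mk hp
    obtain ⟨k, hk⟩ := IsPGroup.iff_card.1 hA
    -- A subgroup of finite index in `ℤ ^ n` is again isomorphic to `ℤ ^ n`.
    obtain ⟨e⟩ := Int.addSubgroup_index_ne_zero_iff.1
      (show φ.1.ker.index ≠ 0 by rw [hker]; exact Nat.card_pos.ne')
    have h := tsum_subgroups_le hp n ⟨φ.1.ker, k, (hker φ).trans hk⟩
    rw [pSubgroupZeta_congr p n e, pSubgroupZeta_pi_int hp] at h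
    simpa only [hker] using h
  have h := tsum_quotientClass hp (G := Fin n → ℤ) (fun B => inferInstance)
    (fun B => (Nat.card (AddSurj B.rep.carrier A) : ℝ≥0∞) *
      ((Nat.card B.rep.carrier : ℝ≥0∞) ^ n)⁻¹)
  simp only [hsur] at h
  rw [ENNReal.tsum_comm] at h
  simp only [hzeta, ENNReal.tsum_const, ENat.card_eq_coe_natCard] at h
  rw [generatingProb, mul_assoc]
  refine Eq.trans (tsum_congr fun B => ?_) h.symm
  rw [generatingProb]
  ring

/-! ### Generation by random elements -/

theorem generatingProb_le_one (n : ℕ) (B : Type*) [AddCommGroup B] [Finite B] :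
    generatingProb n B ≤ 1 := by
  have h : Nat.card (AddSurj (Fin n → ℤ) B) ≤ Nat.card B ^ n :=
    card_piIntHom n B ▸ Nat.card_le_card_of_injective _ Subtype.val_injective
  rw [generatingProb, ← div_eq_mul_inv]
  exact ENNReal.div_le_of_le_mul (by rw [one_mul]; exact_mod_cast h)

/-- A tuple that does not generate `B` lies in a proper subgroup. -/
theorem card_pow_le_card_addSurj_add (n : ℕ) (B : Type*) [AddCommGroup B] [Finite B]
    [Fintype {M : AddSubgroup B // M ≠ ⊤}] :
    Nat.card B ^ n ≤ Nat.card (AddSurj (Fin n → ℤ) B) +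
      ∑ M : {M : AddSubgroup B // M ≠ ⊤}, Nat.card M.1 ^ n := by
  classical
  have hinj : Function.Injective (fun f : (Fin n → ℤ) →+ B =>
      (if h : f.range = ⊤ then Sum.inl ⟨f, AddMonoidHom.range_eq_top.1 h⟩
      else Sum.inr ⟨⟨f.range, h⟩, f.rangeRestrict⟩ :
        AddSurj (Fin n → ℤ) B ⊕ Σ M : {M : AddSubgroup B // M ≠ ⊤}, (Fin n → ℤ) →+ M.1)) := by
    refine Function.LeftInverse.injective
      (g := Sum.elim (fun f => f.1) (fun x => x.1.1.subtype.comp x.2)) fun f => ?_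
    by_cases h : f.range = ⊤
    · simp [h]
    · simp only [h, dite_false, Sum.elim_inr]
      rfl
  have h := Nat.card_le_card_of_injective _ hinj
  rw [card_piIntHom, Nat.card_sum, Nat.card_sigma] at h
  simpa only [card_piIntHom] using h

theorem tendsto_generatingProb (B : Type*) [AddCommGroup B] [Finite B] :
    Filter.Tendsto (fun n => generatingProb n B) Filter.atTop (nhds 1) := by
  have := Fintype.ofFinite {M : AddSubgroup B // M ≠ ⊤}
  have hB0 : (Nat.card B : ℝ≥0∞) ≠ 0 := by exact_mod_cast Nat.card_pos.ne'
  have hBt : (Nat.card B : ℝ≥0∞) ≠ ⊤ := ENNReal.natCast_ne_top _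
  have herr : Filter.Tendsto (fun n : ℕ => ∑ M : {M : AddSubgroup B // M ≠ ⊤},
      ((Nat.card M.1 : ℝ≥0∞) / Nat.card B) ^ n) Filter.atTop (nhds 0) := by
    rw [← Finset.sum_const_zero (s := (Finset.univ : Finset {M : AddSubgroup B // M ≠ ⊤}))]
    refine tendsto_finsetSum _ fun M _ => ENNReal.tendsto_pow_atTop_nhds_zero_of_lt_one ?_
    rw [ENNReal.div_lt_iff (Or.inl hB0) (Or.inl hBt), one_mul]
    have hle : Nat.card M.1 ≤ Nat.card B := AddSubgroup.card_le_card_addGroup M.1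
    have hne : Nat.card M.1 ≠ Nat.card B := fun h => M.2 (AddSubgroup.eq_top_of_card_eq M.1 h)
    exact_mod_cast lt_of_le_of_ne hle hne
  refine tendsto_of_tendsto_of_tendsto_of_le_of_le
    (g := fun n => 1 - ∑ M : {M : AddSubgroup B // M ≠ ⊤},
      ((Nat.card M.1 : ℝ≥0∞) / Nat.card B) ^ n) (h := fun _ => 1) ?_ tendsto_const_nhds ?_
    fun n => generatingProb_le_one n B
  · simpa using ENNReal.Tendsto.sub (tendsto_const_nhds (x := (1 : ℝ≥0∞))) herr
      (Or.inl ENNReal.one_ne_top)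
  · intro n
    have h : ((Nat.card B : ℝ≥0∞)) ^ n ≤ Nat.card (AddSurj (Fin n → ℤ) B) +
        ∑ M : {M : AddSubgroup B // M ≠ ⊤}, (Nat.card M.1 : ℝ≥0∞) ^ n := by
      exact_mod_cast card_pow_le_card_addSurj_add n B
    have h' := mul_le_mul_left h (((Nat.card B : ℝ≥0∞) ^ n)⁻¹)
    rw [ENNReal.mul_inv_cancel (pow_ne_zero _ hB0) (ENNReal.pow_ne_top hBt), add_mul,
      Finset.sum_mul] at h'
    refine tsub_le_iff_right.2 (h'.trans_eq ?_)
    simp only [generatingProb, div_eq_mul_inv, mul_pow, ENNReal.inv_pow]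

/-! ### Passage to the limit -/

theorem one_sub_inv_pow_pos {p : ℕ} (hp : p.Prime) (i : ℕ) : 0 < 1 - ((p : ℝ) ^ (i + 1))⁻¹ :=
  sub_pos.2 (inv_lt_one_of_one_lt₀ (one_lt_pow₀ (by exact_mod_cast hp.one_lt) i.succ_ne_zero))

theorem tprod_one_sub_inv_pow_pos {p : ℕ} (hp : p.Prime) :
    0 < ∏' i : ℕ, (1 - ((p : ℝ) ^ (i + 1))⁻¹) := by
  have h1 : (1 : ℝ) < p := by exact_mod_cast hp.one_lt
  refine lt_of_le_of_ne ?_ (Ne.symm ?_)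
  · exact ge_of_tendsto' (multipliable_cohenLenstra hp).tendsto_prod_tprod_nat
      fun n => Finset.prod_nonneg fun i _ => (one_sub_inv_pow_pos hp i).le
  · refine tprod_one_add_ne_zero_of_summable (f := fun i : ℕ => -((p : ℝ) ^ (i + 1))⁻¹)
      (fun i => by simpa [sub_eq_add_neg] using (one_sub_inv_pow_pos hp i).ne') ?_
    have h := (summable_nat_add_iff 1).2 (summable_geometric_of_lt_one
      (inv_nonneg.2 (zero_le_one.trans h1.le)) (inv_lt_one_of_one_lt₀ h1))
    refine h.congr fun i => ?_
    rw [norm_neg, norm_inv, norm_pow, Real.norm_natCast, inv_pow]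

theorem tendsto_prod_inv {p : ℕ} (hp : p.Prime) :
    Filter.Tendsto (fun n => ∏ i ∈ Finset.range n, (1 - ((p : ℝ≥0∞) ^ (i + 1))⁻¹)⁻¹) Filter.atTop
      (nhds (ENNReal.ofReal (∏' i : ℕ, (1 - ((p : ℝ) ^ (i + 1))⁻¹)))⁻¹) := by
  have h := tendsto_inv_iff.2
    (ENNReal.tendsto_ofReal (multipliable_cohenLenstra hp).tendsto_prod_tprod_nat)
  refine h.congr fun n => ?_
  have hp0 : (0 : ℝ) < p := by exact_mod_cast hp.pos
  have hterm : ∀ i : ℕ, ENNReal.ofReal (1 - ((p : ℝ) ^ (i + 1))⁻¹) =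
      1 - ((p : ℝ≥0∞) ^ (i + 1))⁻¹ := by
    intro i
    rw [ENNReal.ofReal_sub _ (by positivity), ENNReal.ofReal_one,
      ENNReal.ofReal_inv_of_pos (by positivity), ENNReal.ofReal_pow hp0.le, ENNReal.ofReal_natCast]
  rw [ENNReal.ofReal_prod_of_nonneg fun i _ => (one_sub_inv_pow_pos hp i).le,
    ENNReal.prod_inv_distrib fun _ _ _ _ _ => Or.inr ENNReal.ofReal_ne_top]
  simp only [hterm]

/-- The Cohen–Lenstra moments before normalisation, as the limit of `tsum_generatingProb_mul`. The
upper bound comes from finite partial sums, the lower one from `generatingProb n B ≤ 1`. -/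
theorem tsum_card_addSurj_div_card_aut {p : ℕ} (hp : p.Prime) (A : Type*) [AddCommGroup A]
    [Finite A] (hA : IsPGroup p (Multiplicative A)) :
    ∑' B : FinAbPGroupClass p, ((Nat.card (B.rep.carrier ≃+ B.rep.carrier) : ℝ≥0∞)⁻¹ *
        Nat.card (AddSurj B.rep.carrier A)) =
      (ENNReal.ofReal (∏' i : ℕ, (1 - ((p : ℝ) ^ (i + 1))⁻¹)))⁻¹ := by
  have hlim := ENNReal.Tendsto.mul (tendsto_generatingProb A)
    (Or.inl one_ne_zero) (tendsto_prod_inv hp) (Or.inr ENNReal.one_ne_top)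
  rw [one_mul] at hlim
  refine le_antisymm ?_ (le_of_tendsto' hlim fun n => ?_)
  · rw [ENNReal.tsum_eq_iSup_sum]
    refine iSup_le fun s => ?_
    have hs := tendsto_finsetSum s fun (B : FinAbPGroupClass p) _ =>
      ENNReal.Tendsto.mul_const (b := (Nat.card (B.rep.carrier ≃+ B.rep.carrier) : ℝ≥0∞)⁻¹ *
        Nat.card (AddSurj B.rep.carrier A)) (tendsto_generatingProb B.rep.carrier)
        (Or.inl one_ne_zero)
    simp only [one_mul] at hs
    refine le_of_tendsto_of_tendsto' hs hlim fun n => ?_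
    rw [← tsum_generatingProb_mul hp n A hA]
    exact ENNReal.sum_le_tsum s
  · rw [← tsum_generatingProb_mul hp n A hA]
    exact ENNReal.tsum_le_tsum fun B => mul_le_of_le_one_left' (generatingProb_le_one n _)

/-- The Cohen–Lenstra moments: a Cohen–Lenstra random group has on average one surjection
onto `A`. -/
theorem tsum_cohenLenstraWeight_mul_card_addSurj {p : ℕ} (hp : p.Prime) (A : Type*)
    [AddCommGroup A] [Finite A] (hA : IsPGroup p (Multiplicative A)) :
    ∑' B : FinAbPGroupClass p, ENNReal.ofReal (cohenLenstraWeight B.rep) *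
      Nat.card (AddSurj B.rep.carrier A) = 1 := by
  have hpos := tprod_one_sub_inv_pow_pos hp
  have hw : ∀ B : FinAbPGroup p, ENNReal.ofReal (cohenLenstraWeight B) =
      ENNReal.ofReal (∏' i : ℕ, (1 - ((p : ℝ) ^ (i + 1))⁻¹)) *
        (Nat.card (B.carrier ≃+ B.carrier) : ℝ≥0∞)⁻¹ := by
    intro B
    have h0 : (0 : ℝ) < Nat.card (B.carrier ≃+ B.carrier) := by exact_mod_cast Nat.card_pos
    rw [cohenLenstraWeight, mul_comm, ENNReal.ofReal_mul hpos.le, one_div,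
      ENNReal.ofReal_inv_of_pos h0, ENNReal.ofReal_natCast]
  simp only [hw, mul_assoc]
  rw [ENNReal.tsum_mul_left, tsum_card_addSurj_div_card_aut hp A hA,
    ENNReal.mul_inv_cancel (ENNReal.ofReal_pos.2 hpos).ne' ENNReal.ofReal_ne_top]

/-! ### Pointed groups -/

/-- Every surjection `B → A` takes exactly `|B| / |A|` elements of `B` to `a`. -/
theorem sum_card_pointedSur (B A : Type*) [AddCommGroup B] [Fintype B] [AddCommGroup A] [Finite A]
    (a : A) :
    (∑ b : B, Nat.card (PointedSur b a)) * Nat.card A = Nat.card (AddSurj B A) * Nat.card B := by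
  classical
  have hHom : Finite (B →+ A) := DFunLike.finite _
  have := Fintype.ofFinite (AddSurj B A)
  have hfib : ∀ f : AddSurj B A, Nat.card (f.1 ⁻¹' {a}) * Nat.card A = Nat.card B := by
    intro f
    rw [Nat.card_congr (f.1.fiberEquivKerOfSurjective f.2 a),
      ← Nat.card_congr (QuotientAddGroup.quotientKerEquivOfSurjective f.1 f.2).toEquiv]
    exact f.1.ker.card_mul_index
  let e : (Σ b : B, PointedSur b a) ≃ Σ f : AddSurj B A, f.1 ⁻¹' {a} :=
    { toFun := fun x => ⟨⟨x.2.1, x.2.2.1⟩, x.1, x.2.2.2⟩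
      invFun := fun x => ⟨x.2.1, x.1.1, x.1.2, x.2.2⟩
      left_inv := fun _ => rfl
      right_inv := fun _ => rfl }
  have hfin : ∀ b : B, Finite (PointedSur b a) := fun b => Subtype.finite
  rw [← Nat.card_sigma, Nat.card_congr e, Nat.card_sigma, Finset.sum_mul,
    Finset.sum_congr rfl fun f _ => hfib f, Finset.sum_const, Finset.card_univ, smul_eq_mul,
    Nat.card_eq_fintype_card (α := AddSurj B A)]

/-- Pointed surjections out of isomorphic pointed groups correspond. -/
def PointedSur.congrLeft {B C A : Type*} [AddCommGroup B] [AddCommGroup C] [AddCommGroup A]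
    {b : B} {c : C} (e : B ≃+ C) (he : e b = c) (a : A) : PointedSur b a ≃ PointedSur c a where
  toFun f := ⟨f.1.comp e.symm.toAddMonoidHom, f.2.1.comp e.symm.surjective, by
    subst he
    simpa using f.2.2⟩
  invFun f := ⟨f.1.comp e.toAddMonoidHom, f.2.1.comp e.surjective, by
    subst he
    simpa using f.2.2⟩
  left_inv f := Subtype.ext (by ext; simp)
  right_inv f := Subtype.ext (by ext; simp)

/-- The number of pointed surjections does not depend on the chosen representative. -/
theorem card_pointedSur_rep {p : ℕ} {A : Type*} [AddCommGroup A] (B : FinAbPGroup p)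
    (b : B.carrier) (a : A) :
    Nat.card (PointedSur (B.pointedClass b).rep.point a) = Nat.card (PointedSur b a) := by
  have h : PointedFinAbPGroup.isoSetoid p (B.pointedClass b).rep ⟨B, b⟩ :=
    Quotient.mk_out (s := PointedFinAbPGroup.isoSetoid p) (⟨B, b⟩ : PointedFinAbPGroup p)
  obtain ⟨e, he⟩ := h
  exact Nat.card_congr (PointedSur.congrLeft e he a)

/-- The mean of a function of the class of `(B, b)`, for uniform `b`. -/
theorem tsum_mul_uniformPointing {p : ℕ} (B : FinAbPGroup p) [inst : Fintype B.carrier]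
    (F : PointedFinAbPGroupClass p → ℝ≥0∞) :
    ∑' X, F X * uniformPointing B {X} =
      (∑ b : B.carrier, F (B.pointedClass b)) * (Nat.card B.carrier : ℝ≥0∞)⁻¹ := by
  classical
  have h : ∀ X, uniformPointing B {X} =
      ∑ b : B.carrier, if X = B.pointedClass b then (Nat.card B.carrier : ℝ≥0∞)⁻¹ else 0 := by
    intro X
    -- `uniformPointing` is built on the instance `Fintype.ofFinite`.
    rw [uniformPointing, Subsingleton.elim (Fintype.ofFinite B.carrier) inst,
      PMF.toMeasure_apply_singleton _ _ MeasurableSpace.measurableSet_top, PMF.map_apply,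
      tsum_fintype]
    refine Finset.sum_congr rfl fun b _ => ?_
    rw [PMF.uniformOfFintype_apply, Nat.card_eq_fintype_card]
  simp only [h, Finset.mul_sum]
  rw [Summable.tsum_finsetSum fun _ _ => ENNReal.summable, Finset.sum_mul]
  refine Finset.sum_congr rfl fun b _ => ?_
  rw [tsum_eq_single (B.pointedClass b) fun X hX => by rw [if_neg hX, mul_zero], if_pos rfl]

theorem pointedMeasure_singleton {p : ℕ} (X : PointedFinAbPGroupClass p) :
    pointedMeasure p {X} = ∑' B : FinAbPGroupClass p,
      ENNReal.ofReal (cohenLenstraWeight B.rep) * uniformPointing B.rep {X} := by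
  rw [pointedMeasure, Measure.bind_apply MeasurableSpace.measurableSet_top
    measurable_from_top.aemeasurable, cohenLenstraMeasure, lintegral_sum_measure]
  refine tsum_congr fun B => ?_
  rw [lintegral_smul_measure, lintegral_dirac' B measurable_from_top, smul_eq_mul]

theorem lemma1p1 (p : ℕ) (hp : p.Prime) (hp_odd : Odd p)
    (A : Type*) [AddCommGroup A] [Finite A] (hA : IsPGroup p (Multiplicative A)) (a : A) :
    ∑' B : PointedFinAbPGroupClass p,
      (Nat.card (PointedSur B.rep.point a) : ℝ≥0∞) * pointedMeasure p {B}
        = 1 / (Nat.card A : ℝ≥0∞) := by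
  have hA0 : (Nat.card A : ℝ≥0∞) ≠ 0 := by exact_mod_cast Nat.card_pos.ne'
  have hfib : ∀ B : FinAbPGroup p,
      ∑' X : PointedFinAbPGroupClass p, (Nat.card (PointedSur X.rep.point a) : ℝ≥0∞) *
          uniformPointing B {X} = Nat.card (AddSurj B.carrier A) * (Nat.card A : ℝ≥0∞)⁻¹ := by
    intro B
    have := Fintype.ofFinite B.carrier
    have hB0 : (Nat.card B.carrier : ℝ≥0∞) ≠ 0 := by exact_mod_cast Nat.card_pos.ne'
    have h : (∑ b : B.carrier, (Nat.card (PointedSur b a) : ℝ≥0∞)) * Nat.card A =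
        Nat.card (AddSurj B.carrier A) * Nat.card B.carrier := by
      exact_mod_cast sum_card_pointedSur B.carrier A a
    rw [tsum_mul_uniformPointing]
    simp only [card_pointedSur_rep]
    rw [← div_eq_mul_inv, ← div_eq_mul_inv, ENNReal.div_eq_div_iff hA0 (ENNReal.natCast_ne_top _)
      hB0 (ENNReal.natCast_ne_top _), mul_comm, h, mul_comm]
  simp only [pointedMeasure_singleton, ← ENNReal.tsum_mul_left]
  rw [ENNReal.tsum_comm]
  simp only [mul_left_comm _ (ENNReal.ofReal _), ENNReal.tsum_mul_left, hfib]
  simp only [← mul_assoc, ENNReal.tsum_mul_right]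
  rw [tsum_cohenLenstraWeight_mul_card_addSurj hp A hA, one_div, one_mul]
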